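/- Let $k$ be a field of characteristic different from $2$, let $B$ be a (finite-dimensional) central division $k$-algebra, and let $\tau$ be a unitary involution on $B$, i.e. an involution whose restriction to $k$ is not the identity. Let $k_0$ be the fixed field of $\tau|_k$, so that $k/k_0$ is a quadratic extension, and let $d\in k_0$ be such that $k=k_0(\sqrt{-d})$. Let $L_0$ be a maximal element, with respect to inclusion, of the set of subfields of $B$ that contain $k_0$ and consist of $\tau$-symmetric elements (elements $x$ with $\tau(x)=x$), and let $L=L_0(\sqrt{-d})\subseteq B$. Assume that $L/k$ is Galois. Assume moreover that there is an ordering $P$ of $k_0$ at which $\tau$ is positive, i.e. such that $\operatorname{Trd}_B(\tau(x)x)>_P 0$ for every nonzero $x\in B$, where $\operatorname{Trd}_B$ denotes the reduced trace of $B$ (here $\operatorname{Trd}_B(\tau(x)x)\in k_0$). Then $\tau$ restricts to a $k_0$-automorphism $\tau|_L$ of $L$, and $\tau|_L\circ\gamma=\gamma\circ\tau|_L$ for every $\gamma\in\operatorname{Gal}(L/k_0)$. In particular, $\tau|_L\circ\gamma=\gamma\circ\tau|_L$ for every $\gamma\in\operatorname{Gal}(L/k)$. -/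

import Mathlib

open scoped TensorProduct

section Definitions

/-- `c` is the reduced trace `Trd_B(b)` of the element `b` of the central simple `k`-algebra `B`:
the trace of the matrix of `1 ⊗ b` under an isomorphism of `k̄`-algebras `k̄ ⊗ B ≅ M_n(k̄)`, where
`k̄` is an algebraic closure of `k`. Such an isomorphism exists, and the trace
does not depend on it (Skolem-Noether). -/
def IsReducedTrace (k : Type*) {B : Type*} [Field k] [Ring B] [Algebra k B] (b : B) (c : k) :
    Prop :=
  ∃ (n : ℕ) (φ : AlgebraicClosure k ⊗[k] B ≃ₐ[AlgebraicClosure k]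
      Matrix (Fin n) (Fin n) (AlgebraicClosure k)),
    (φ (1 ⊗ₜ[k] b)).trace = algebraMap k (AlgebraicClosure k) c

/-- The involution `star` of the `k`-algebra `B` is unitary, and `k₀` is the fixed field of its
restriction to the centre `k`. -/
structure IsUnitaryInvolution (k₀ k B : Type*) [Field k₀] [Field k] [Ring B] [StarRing B]
    [Algebra k₀ k] [Algebra k B] : Prop where
  nontrivial : ∃ c : k, star (algebraMap k B c) ≠ algebraMap k B c
  fixed_iff : ∀ c : k,
    star (algebraMap k B c) = algebraMap k B c ↔ c ∈ Set.range (algebraMap k₀ k)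

/-- The involution `star` of `B` is positive at the given ordering of `k₀`: the form
`x ↦ Trd_B(star x * x)` has its values in `k₀` and is positive definite. -/
def IsPositiveInvolution (k₀ k B : Type*) [Field k₀] [LinearOrder k₀] [Field k] [Ring B]
    [StarRing B] [Algebra k₀ k] [Algebra k B] : Prop :=
  ∀ x : B, x ≠ 0 → ∃ c : k₀, 0 < c ∧ IsReducedTrace k (star x * x) (algebraMap k₀ k c)

/-- `F` is a (commutative) subfield of `B` that contains `k₀` and consists of symmetric
elements. -/
structure IsSymmetricSubfield (k₀ : Type*) {B : Type*} [Field k₀] [DivisionRing B] [StarRing B]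
    [Algebra k₀ B] (F : Subfield B) : Prop where
  mul_comm : ∀ x ∈ F, ∀ y ∈ F, x * y = y * x
  star_eq : ∀ x ∈ F, star x = x
  algebraMap_mem : ∀ c : k₀, algebraMap k₀ B c ∈ F

/-- The `k`-subalgebra `L` of `B` is a field, and it is a Galois extension of `k`. -/
def IsGaloisSubalgebra {k B : Type*} [Field k] [Ring B] [Algebra k B] (L : Subalgebra k B) :
    Prop :=
  ∃ h : IsField L, @IsGalois k _ L h.toField L.algebra

end Definitions

open Module

/-! Positivity descends from `B` to `L`. Left multiplication on `B` by `x` in `L` has trace `n *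
Trd(x)`, and also `[B : L] * Tr_{L/k}(x)`, since `B` is an `L`-vector space. Taking traces down to
`k₀` leaves only positive integer factors, so `Tr_{L/k₀}(τ(x) x) > 0` for `x ≠ 0`. On the field `L`,
the conjugate `τ' = γ⁻¹ τ γ` is then another positive involution. The product `θ = τ τ'` is positive
and self-adjoint for `Tr(τ(x) y)`, and of finite order because `L/k₀` is finite. This forces `θ =
1`, that is `τ' = τ`. -/

/-- An involution `τ` for which the form `Tr(τ(x) x)` is positive definite commutes with every
automorphism `γ`: for the form `Tr(τ(x) y)`, the operator `τ γ⁻¹ τ γ` is positive, self-adjoint and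
of finite order, hence trivial. -/
theorem AlgEquiv.commute_of_trace_pos {F E : Type*} [Field F] [LinearOrder F]
    [IsStrictOrderedRing F] [Field E] [Algebra F E] [FiniteDimensional F E] (τ γ : E ≃ₐ[F] E)
    (hτ : ∀ x, τ (τ x) = x)
    (hpos : ∀ x, x ≠ 0 → 0 < Algebra.trace F E (τ x * x)) (x : E) :
    τ (γ x) = γ (τ x) := by
  have htr : ∀ (σ : E ≃ₐ[F] E) (x : E), Algebra.trace F E (σ x) = Algebra.trace F E x :=
    fun σ x ↦ Algebra.trace_eq_of_algEquiv σ x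
  set τ' : E ≃ₐ[F] E := γ⁻¹ * τ * γ
  have hτ'apply : ∀ x, τ' x = γ.symm (τ (γ x)) := fun x ↦ rfl
  have hτ' : ∀ x, τ' (τ' x) = x := fun x ↦ by simp [hτ'apply, hτ]
  have hpos' : ∀ x, x ≠ 0 → 0 < Algebra.trace F E (τ' x * x) := fun x hx ↦ by
    rw [← htr γ, map_mul, hτ'apply, AlgEquiv.apply_symm_apply]
    exact hpos _ (by simpa using hx)
  set θ : E ≃ₐ[F] E := τ * τ'
  have hθ : ∀ x, θ x = τ (τ' x) := fun x ↦ rfl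
  have hadj : ∀ x y, Algebra.trace F E (τ (θ x) * y) = Algebra.trace F E (τ x * θ y) := by
    intro x y
    rw [hθ, hθ, hτ, ← map_mul τ, htr, ← htr τ' (x * τ' y), map_mul τ', hτ']
  -- By self-adjointness, the form of `θ ^ (j + 2)` at `z` is that of `θ ^ j` at `θ z`. This leaves
  -- `j = 0`, the form of `τ`, and `j = 1`, the form of `τ'`.
  have hpow : ∀ j : ℕ, ∀ z : E, z ≠ 0 → 0 < Algebra.trace F E (τ z * (θ ^ j) z) := by
    intro j
    induction j using Nat.twoStepInduction with
    | zero => simpa using hpos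
    | one =>
      intro z hz
      rw [pow_one, ← hadj, hθ, hτ]
      exact hpos' z hz
    | more j ih _ =>
      intro z hz
      have h := ih (θ z) (by simpa using hz)
      rw [hadj] at h
      rwa [pow_succ, pow_succ', AlgEquiv.mul_apply, AlgEquiv.mul_apply]
  obtain ⟨m, hm, hm1⟩ := (isOfFinOrder_of_finite θ).exists_pow_eq_one
  -- A telescoping sum replaces the spectral theorem, so any ordered field will do: for `z = θ y -
  -- y` the `θ ^ j z` add up to `0` over a period, yet each pairs positively with `z`.
  have hfix : ∀ y, θ y = y := by
    intro y
    by_contra hne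
    have hz : θ y - y ≠ 0 := sub_ne_zero.2 hne
    have hsum : ∑ j ∈ Finset.range m, (θ ^ j) (θ y - y) = 0 := by
      have : ∀ j, (θ ^ j) (θ y - y) = (θ ^ (j + 1)) y - (θ ^ j) y := fun j ↦ by
        rw [map_sub, pow_succ θ j, AlgEquiv.mul_apply (θ ^ j) θ]
      simp only [this]
      rw [Finset.sum_range_sub (fun j ↦ (θ ^ j) y), hm1]
      simp
    have hlt : 0 < ∑ j ∈ Finset.range m,
        Algebra.trace F E (τ (θ y - y) * (θ ^ j) (θ y - y)) :=
      Finset.sum_pos (fun j _ ↦ hpow j _ hz) (Finset.nonempty_range_iff.2 hm.ne')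
    rw [← map_sum, ← Finset.mul_sum, hsum, mul_zero, map_zero] at hlt
    exact lt_irrefl _ hlt
  have h1 : τ' x = τ x := by
    have := congrArg τ (hfix x)
    rwa [hθ, hτ] at this
  rw [← h1, hτ'apply, AlgEquiv.apply_symm_apply]

/-- Left multiplication by a matrix `M` on `n × n` matrices has trace `n * tr M`. -/
theorem Matrix.trace_lmul_eq {n R : Type*} [Fintype n] [DecidableEq n] [CommRing R]
    (M : Matrix n n R) :
    LinearMap.trace R (Matrix n n R) (Algebra.lmul R _ M) = Fintype.card n * M.trace := by
  rw [LinearMap.trace_eq_matrix_trace R (Matrix.stdBasis R n n), Matrix.trace,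
    Fintype.sum_prod_type]
  have : ∀ i j : n, LinearMap.toMatrix (Matrix.stdBasis R n n) (Matrix.stdBasis R n n)
      (Algebra.lmul R _ M) (i, j) (i, j) = M i i := by
    intro i j
    rw [LinearMap.toMatrix_apply, Matrix.stdBasis_eq_single]
    change (M * Matrix.single i j (1 : R) : Matrix n n R) i j = M i i
    simp
  simp [Matrix.diag, this, Matrix.trace, Finset.mul_sum, -Algebra.coe_lmul_eq_mul]

/-- The trace over `k` of a homothety of an `L`-vector space. -/
theorem LinearMap.trace_lsmul_eq_finrank_mul {k L V : Type*} [Field k] [Field L] [Algebra k L]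
    [FiniteDimensional k L] [AddCommGroup V] [Module k V] [Module L V] [IsScalarTower k L V]
    [FiniteDimensional L V] (x : L) :
    LinearMap.trace k V (Algebra.lsmul k k V x) = finrank L V * Algebra.trace k L x := by
  classical
  let b := finBasis k L
  let c := finBasis L V
  rw [LinearMap.trace_eq_matrix_trace k (b.smulTower c), Algebra.trace_eq_matrix_trace b,
    Matrix.trace, Fintype.sum_prod_type, Finset.sum_comm]
  have : ∀ i j, LinearMap.toMatrix (b.smulTower c) (b.smulTower c) (Algebra.lsmul k k V x)
      (i, j) (i, j) = Algebra.leftMulMatrix b x i i := by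
    intro i j
    rw [LinearMap.toMatrix_apply, Algebra.leftMulMatrix_eq_repr_mul, Basis.smulTower_apply,
      Basis.smulTower_repr]
    change b.repr (c.repr (x • b i • c j) j) i = _
    rw [← mul_smul]
    simp
  simp [Matrix.diag, this, Matrix.trace]

/-- Left multiplication by `b` has trace `n * Trd(b)`, where `n` is the degree. -/
theorem IsReducedTrace.exists_trace_lmul_eq {k B : Type*} [Field k] [Ring B] [Algebra k B]
    [Nontrivial B] [FiniteDimensional k B] {b : B} {c : k} (h : IsReducedTrace k b c) :
    ∃ n : ℕ, n ≠ 0 ∧ LinearMap.trace k B (Algebra.lmul k B b) = n * c := by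
  obtain ⟨n, φ, h⟩ := h
  refine ⟨n, ?_, ?_⟩
  · rintro rfl
    exact not_subsingleton _ φ.toEquiv.subsingleton
  · apply FaithfulSMul.algebraMap_injective k (AlgebraicClosure k)
    have hbc : (Algebra.lmul k B b).baseChange (AlgebraicClosure k) =
        Algebra.lmul (AlgebraicClosure k) (AlgebraicClosure k ⊗[k] B) (1 ⊗ₜ b) := by
      ext y
      simp
    have hconj : φ.toLinearEquiv.conj
        (Algebra.lmul (AlgebraicClosure k) (AlgebraicClosure k ⊗[k] B) (1 ⊗ₜ b)) =
        Algebra.lmul (AlgebraicClosure k) _ (φ (1 ⊗ₜ b)) := by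
      apply LinearMap.ext
      intro y
      simp [LinearEquiv.conj_apply]
    rw [← LinearMap.trace_baseChange, hbc,
      ← LinearMap.trace_conj' _ φ.toLinearEquiv, hconj,
      Matrix.trace_lmul_eq, h]
    simp

/-- An element of a subfield `L` of `B` with positive reduced trace has positive trace to the
ordered subfield `F`. -/
theorem IsReducedTrace.trace_pos {F k L B : Type*} [Field F] [LinearOrder F]
    [IsStrictOrderedRing F] [Field k] [Field L] [Ring B] [Nontrivial B] [Algebra F k] [Algebra k L]
    [Algebra F L] [IsScalarTower F k L] [Algebra k B] [FiniteDimensional F k]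
    [FiniteDimensional k B] (ι : L →ₐ[k] B) {x : L} {c : F} (hc : 0 < c)
    (h : IsReducedTrace k (ι x) (algebraMap F k c)) : 0 < Algebra.trace F L x := by
  -- With this structure, left multiplication by `ι x` is a homothety of an `L`-vector space.
  let : Module L B := Module.compHom B ι.toRingHom
  have hsmul : ∀ (a : L) (y : B), a • y = ι a * y := fun _ _ ↦ rfl
  have : IsScalarTower k L B := ⟨fun a l y ↦ by simp [hsmul]⟩
  have : FiniteDimensional L B := Module.Finite.right k L B
  have : FiniteDimensional k L := FiniteDimensional.of_injective ι.toLinearMap ι.injective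
  obtain ⟨n, hn, hnc⟩ := h.exists_trace_lmul_eq
  have hr : 0 < finrank L B := finrank_pos
  have hlm : Algebra.lmul k B (ι x) = Algebra.lsmul k k B x := by
    ext y
    simp [hsmul]
  rw [hlm, LinearMap.trace_lsmul_eq_finrank_mul] at hnc
  -- Apply the trace of `k/F` to `hnc`; the factor `[k : F]` appears because `n * c` lies in `F`.
  have key : (finrank L B : F) * Algebra.trace F L x = finrank F k * (n * c) := by
    have h2 := congrArg (Algebra.trace F k) hnc
    rw [← nsmul_eq_mul, map_nsmul, Algebra.trace_trace, nsmul_eq_mul] at h2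
    rw [h2, ← map_natCast (algebraMap F k), ← map_mul, Algebra.trace_algebraMap, nsmul_eq_mul]
  have hd : 0 < finrank F k := finrank_pos
  have hpos : (0 : F) < finrank F k * (n * c) := by
    have : 0 < n := Nat.pos_of_ne_zero hn
    positivity
  rw [← key] at hpos
  exact pos_of_mul_pos_right hpos (by positivity)

/-- If `star` maps `S` into the subfield generated by `S`, then this subfield is stable under
`star`. -/
theorem Subfield.star_mem_closure {B : Type*} [DivisionRing B] [StarRing B] {S : Set B}
    (hS : ∀ x ∈ S, star x ∈ Subfield.closure S) {x : B} (hx : x ∈ Subfield.closure S) :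
    star x ∈ Subfield.closure S := by
  induction hx using Subfield.closure_induction with
  | mem x hx => exact hS x hx
  | one => simp
  | add x y _ _ hx hy => rw [star_add]; exact add_mem hx hy
  | neg x _ hx => rw [star_neg]; exact neg_mem hx
  | inv x _ hx => rw [star_inv₀]; exact inv_mem hx
  | mul x y _ _ hx hy => rw [star_mul]; exact mul_mem hy hx

/-- A star-stable commutative subalgebra carries the restriction of `star` as an algebra
automorphism over any field of central symmetric elements. -/
theorem Subalgebra.exists_algEquiv_star {F k B : Type*} [Field F] [Field k] [Ring B] [StarRing B]
    [Algebra F k] [Algebra k B] [Algebra F B] [IsScalarTower F k B] (L : Subalgebra k B)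
    (hcomm : ∀ x y : L, x * y = y * x) (hstar : ∀ x ∈ L, star x ∈ L)
    (hF : ∀ c : F, star (algebraMap F B c) = algebraMap F B c) :
    ∃ τ : L ≃ₐ[F] L, ∀ x : L, (τ x : B) = star (x : B) := by
  let f : L →ₐ[F] L :=
    { toFun := fun x ↦ ⟨star (x : B), hstar _ x.2⟩
      map_one' := Subtype.ext (star_one B)
      map_mul' := fun x y ↦ by
        rw [hcomm x y]
        exact Subtype.ext (star_mul _ _)
      map_zero' := Subtype.ext (star_zero B)
      map_add' := fun x y ↦ Subtype.ext (star_add _ _)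
      commutes' := fun c ↦ Subtype.ext (hF c) }
  have hf : f.comp f = AlgHom.id F L := AlgHom.ext fun x ↦ Subtype.ext (star_star (x : B))
  exact ⟨AlgEquiv.ofAlgHom f f hf hf, fun x ↦ rfl⟩

theorem corollary2p4 {k₀ k B : Type*} [Field k₀] [Field k] [DivisionRing B] [StarRing B]
    [Algebra k₀ k] [Algebra k B] [Algebra k₀ B] [IsScalarTower k₀ k B]
    [Algebra.IsCentral k B] [FiniteDimensional k B]
    (hchar : ringChar k ≠ 2)
    (hunitary : IsUnitaryInvolution k₀ k B)
    (d : k₀) (s : k) (hs : s ^ 2 = -algebraMap k₀ k d) (hk : IntermediateField.adjoin k₀ {s} = ⊤)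
    (L₀ : Subfield B) (hL₀ : Maximal (IsSymmetricSubfield k₀) L₀)
    (L : Subalgebra k B)
    (hL : (L : Set B) = Subfield.closure ((L₀ : Set B) ∪ {algebraMap k B s}))
    (hGal : IsGaloisSubalgebra L)
    (hpos : ∃ (P : LinearOrder k₀) (_ : IsStrictOrderedRing k₀), IsPositiveInvolution k₀ k B) :
    ∃ τL : L ≃ₐ[k₀] L, (∀ x : L, (τL x : B) = star (x : B)) ∧
      (∀ γ : L ≃ₐ[k₀] L, τL ∘ γ = γ ∘ τL) ∧
      (∀ γ : L ≃ₐ[k] L, τL ∘ γ = γ ∘ τL) := by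
  obtain ⟨hfield, -⟩ := hGal
  obtain ⟨_, _, hpos⟩ := hpos
  have hF : ∀ c : k₀, star (algebraMap k₀ B c) = algebraMap k₀ B c := fun c ↦ by
    rw [IsScalarTower.algebraMap_apply k₀ k B]
    exact (hunitary.fixed_iff _).2 ⟨c, rfl⟩
  -- `star s` and `s` have the same square, `-d`, which is symmetric. Either sign keeps `L` stable
  -- under `star`.
  have hstars : star (algebraMap k B s) = algebraMap k B s ∨
      star (algebraMap k B s) = -algebraMap k B s := by
    have hcomm : Commute (star (algebraMap k B s)) (algebraMap k B s) :=
      (Algebra.commutes s _).symm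
    rw [← hcomm.sq_eq_sq_iff_eq_or_eq_neg, ← star_pow, ← map_pow, hs, map_neg, star_neg,
      ← IsScalarTower.algebraMap_apply, hF]
  have hLmem : ∀ x, x ∈ L ↔ x ∈ Subfield.closure ((L₀ : Set B) ∪ {algebraMap k B s}) := fun x ↦ by
    rw [← SetLike.mem_coe, hL, SetLike.mem_coe]
  have hstar : ∀ x ∈ L, star x ∈ L := fun x hx ↦ by
    rw [hLmem] at hx ⊢
    refine Subfield.star_mem_closure ?_ hx
    rintro y (hy | rfl)
    · rw [hL₀.prop.star_eq y hy]
      exact Subfield.subset_closure (Or.inl hy)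
    · have hmem := Subfield.subset_closure (s := (L₀ : Set B) ∪ {algebraMap k B s})
        (Or.inr rfl : algebraMap k B s ∈ _)
      rcases hstars with h | h <;> rw [h]
      exacts [hmem, neg_mem hmem]
  obtain ⟨τ, hτ⟩ := L.exists_algEquiv_star hfield.mul_comm hstar hF
  have : FiniteDimensional k₀ k := by
    have hint : IsIntegral k₀ s := by
      refine IsIntegral.of_pow two_pos ?_
      rw [hs, ← map_neg]
      exact isIntegral_algebraMap
    have := IntermediateField.adjoin.finiteDimensional hint
    rw [hk] at this
    exact IntermediateField.topEquiv.toLinearEquiv.finiteDimensional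
  have : FiniteDimensional k₀ L := Module.Finite.trans k L
  let := hfield.toField
  have hcom : ∀ (γ : L ≃ₐ[k₀] L) (x : L), τ (γ x) = γ (τ x) := fun γ x ↦ by
    refine AlgEquiv.commute_of_trace_pos τ γ (fun y ↦ Subtype.ext (by simp [hτ])) ?_ x
    intro y hy
    obtain ⟨c, hc, h⟩ := hpos (y : B) (by simpa using hy)
    refine IsReducedTrace.trace_pos L.val hc ?_
    rw [map_mul]
    change IsReducedTrace k ((τ y : B) * (y : B)) _
    rwa [hτ]
  exact ⟨τ, hτ, fun γ ↦ funext (hcom γ), fun γ ↦ funext (hcom (γ.restrictScalars k₀))⟩
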